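/- Let $T$ be a directed tree: a finite directed graph without loops, with at most one arrow from $v$ to $w$ for each ordered pair of vertices $(v,w)$ (opposite arrows $v\to w$ and $w\to v$ may both be present, forming a bi-directional arrow), whose underlying undirected graph, in which distinct vertices are adjacent if and only if there is an arrow between them in at least one direction, is a tree (connected and acyclic, with at least one vertex). Let $L_T$ be its Laplacian matrix: its $(v,v)$ entry is the number of arrows going out of $v$, and for $v\neq w$ its $(v,w)$ entry is minus the number of arrows from $v$ to $w$. Let $\operatorname{Pic}(T)=\mathbb{Z}^{V(T)}/L_T^{\mathsf T}\,\mathbb{Z}^{V(T)}$ be the Picard group of $T$. A strong component of $T$ is an equivalence class of vertices under mutual reachability by (possibly empty) directed paths; it is terminal if no arrow goes from a vertex in it to a vertex outside it. Let $r$ be the number of terminal strong components of $T$. Then $\operatorname{Pic}(T)$ is a free abelian group of rank $r$. -/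

import Mathlib

/-!
A directed graph is a quiver: a vertex type `V` with a type `v ⟶ w` of arrows from `v` to `w`
(so parallel arrows are possible). A bi-directional arrow between `v` and `w` is a pair of opposite
arrows `v ⟶ w` and `w ⟶ v`. Graphs in the sense used here are finite and have no loops.
-/

namespace DirectedGraph

/-- The Laplacian matrix: the out-degree of `v` on the diagonal, and minus the number of arrows
from `v` to `w` in entry `(v, w)`, `v ≠ w`. -/
noncomputable def laplacian (V : Type*) [Quiver V] [DecidableEq V] : Matrix V V ℤ :=
  Matrix.of fun v w =>
    if v = w then (Nat.card (Quiver.Star v) : ℤ) else -(Nat.card (v ⟶ w) : ℤ)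

/-- The Picard group: the cokernel of the transpose of the Laplacian matrix acting on `ℤ ^ V`. -/
abbrev Pic (V : Type*) [Quiver V] [Fintype V] [DecidableEq V] : Type _ :=
  (V → ℤ) ⧸ LinearMap.range (Matrix.toLin' (laplacian V).transpose)

/-- The underlying undirected simple graph: distinct vertices are adjacent when there is an arrow
between them, in either direction. -/
def underlying (V : Type*) [Quiver V] : SimpleGraph V :=
  SimpleGraph.fromRel fun v w => Nonempty (v ⟶ w)

/-- A directed tree: no loops, no parallel arrows (at most one arrow from `v` to `w`; opposite
arrows are allowed), and the underlying undirected graph is a tree. -/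
structure IsDirectedTree (V : Type*) [Quiver V] : Prop where
  loopless : ∀ v : V, IsEmpty (v ⟶ v)
  no_parallel : ∀ v w : V, Subsingleton (v ⟶ w)
  isTree : (underlying V).IsTree

/-- A strong component is terminal if no arrow leads from a vertex in it to a vertex outside. -/
def IsTerminal {V : Type*} [Quiver V] (c : Quiver.StronglyConnectedComponent V) : Prop :=
  ∀ v w : V, Quiver.StronglyConnectedComponent.mk v = c → Nonempty (v ⟶ w) →
    Quiver.StronglyConnectedComponent.mk w = c

/-- The number of terminal strong components. -/
noncomputable def numTerminal (V : Type*) [Quiver V] : ℕ :=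
  Nat.card {c : Quiver.StronglyConnectedComponent V // IsTerminal c}

end DirectedGraph

/-! `Pic` is the quotient of `ℤ ^ V` by the row span of the Laplacian. In a tree every arrow inside
a strong component is bi-directional, so the rows over a terminal component sum to zero, and one row
per terminal component (its root) can be dropped (`span_row_eq`). Each remaining vertex `v` has an
arrow `v ⟶ p v` to a vertex closer to a root. Pair the rows with the indicators of the cuts along
these edges: the Laplacian of such an indicator lives on the two ends of its edge, so the pairing
matrix is triangular for the distance, with ones on the diagonal (`exists_dual`). Hence the
remaining rows are a basis of a direct summand, and the quotient is free of rank the number of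
roots. -/

namespace DirectedGraph

/-! ### Linear algebra: unimodular pairings and free quotients. -/

section Quotient

variable {R M S : Type*} [CommRing R] [AddCommGroup M] [Module R M] [Fintype S] [DecidableEq S]

/-- Vectors that pair unimodularly with a family of functionals span a complement of the common
kernel of the functionals. -/
theorem isCompl_span_ker_of_det_eq_one (b : S → M) (ε : S → M →ₗ[R] R)
    (h : (Matrix.of fun i j => ε i (b j)).det = 1) :
    IsCompl (Submodule.span R (Set.range b)) (LinearMap.ker (LinearMap.pi ε)) := by
  set P : Matrix S S R := Matrix.of fun i j => ε i (b j) with hP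
  have hu : IsUnit P.det := by rw [h]; exact isUnit_one
  have key : ∀ c : S → R, LinearMap.pi ε (∑ j, c j • b j) = P.mulVec c := by
    intro c
    ext i
    simp [hP, Matrix.mulVec, dotProduct, mul_comm]
  refine ⟨Submodule.disjoint_def.2 fun x hx hx' => ?_, codisjoint_iff.2 <| eq_top_iff.2 ?_⟩
  · obtain ⟨c, rfl⟩ := (Submodule.mem_span_range_iff_exists_fun R).1 hx
    rw [LinearMap.mem_ker, key] at hx'
    have hc : c = 0 := by
      have := congrArg (P⁻¹.mulVec) hx'
      simpa [Matrix.mulVec_mulVec, Matrix.nonsing_inv_mul P hu] using this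
    simp [hc]
  · intro x _
    -- These coefficients make `x - ∑ j, c j • b j` vanish under every functional.
    set c := P⁻¹.mulVec (LinearMap.pi ε x) with hc
    refine Submodule.mem_sup.2 ⟨∑ j, c j • b j,
      (Submodule.mem_span_range_iff_exists_fun R).2 ⟨c, rfl⟩, x - ∑ j, c j • b j, ?_, by abel⟩
    rw [LinearMap.mem_ker, map_sub, key, hc, Matrix.mulVec_mulVec, Matrix.mul_nonsing_inv P hu,
      Matrix.one_mulVec, sub_self]

theorem range_pi_of_det_eq_one (b : S → M) (ε : S → M →ₗ[R] R)
    (h : (Matrix.of fun i j => ε i (b j)).det = 1) :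
    LinearMap.range (LinearMap.pi ε) = ⊤ := by
  set P : Matrix S S R := Matrix.of fun i j => ε i (b j) with hP
  have hu : IsUnit P.det := by rw [h]; exact isUnit_one
  refine LinearMap.range_eq_top.2 fun y => ⟨∑ j, P⁻¹.mulVec y j • b j, ?_⟩
  have : LinearMap.pi ε (∑ j, P⁻¹.mulVec y j • b j) = P.mulVec (P⁻¹.mulVec y) := by
    ext i
    rw [LinearMap.pi_apply, map_sum]
    exact Finset.sum_congr rfl fun j _ => by rw [map_smul, smul_eq_mul, mul_comm]; rfl
  rw [this, Matrix.mulVec_mulVec, Matrix.mul_nonsing_inv P hu, Matrix.one_mulVec]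

/-- The quotient by vectors that pair unimodularly with a family of functionals is free. -/
theorem free_quotient_span_of_det_eq_one [IsDomain R] [IsPrincipalIdealRing R] [Module.Free R M] [Module.Finite R M]
    (b : S → M) (ε : S → M →ₗ[R] R) (h : (Matrix.of fun i j => ε i (b j)).det = 1) :
    Module.Free R (M ⧸ Submodule.span R (Set.range b)) ∧
      Fintype.card S + Module.finrank R (M ⧸ Submodule.span R (Set.range b)) =
        Module.finrank R M := by
  have e := Submodule.quotientEquivOfIsCompl _ _ (isCompl_span_ker_of_det_eq_one b ε h)
  refine ⟨Module.Free.of_equiv e.symm, ?_⟩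
  have hrank := (LinearMap.ker (LinearMap.pi ε)).finrank_quotient_add_finrank
  rwa [((LinearMap.pi ε).quotKerEquivOfSurjective
    (LinearMap.range_eq_top.1 (range_pi_of_det_eq_one b ε h))).finrank_eq,
    Module.finrank_fintype_fun_eq_card, ← e.finrank_eq] at hrank

/-- If `B * X` has determinant one for some `X`, then the quotient by the rows of `B` is free. -/
theorem free_quotient_span_row_of_det_eq_one [IsDomain R] [IsPrincipalIdealRing R] {n : Type*}
    [Fintype n] (B : Matrix S n R) (X : Matrix n S R) (h : (B * X).det = 1) :
    Module.Free R ((n → R) ⧸ Submodule.span R (Set.range B.row)) ∧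
      Fintype.card S + Module.finrank R ((n → R) ⧸ Submodule.span R (Set.range B.row)) =
        Fintype.card n := by
  have key := free_quotient_span_of_det_eq_one B.row
    (fun i => (∑ u, X u i • LinearMap.proj u : (n → R) →ₗ[R] R)) ?_
  · rwa [Module.finrank_fintype_fun_eq_card] at key
  · rw [← h, ← Matrix.det_transpose (B * X)]
    congr 1
    ext i j
    simp [Matrix.mul_apply, Matrix.row, mul_comm]

end Quotient

/-! ### The Laplacian and cuts of a directed tree. -/

section Laplacian

variable {V : Type*} [Quiver V]

theorem card_star [Fintype V] [∀ v w : V, Finite (v ⟶ w)] (v : V) :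
    Nat.card (Quiver.Star v) = ∑ w, Nat.card (v ⟶ w) :=
  Nat.card_sigma

/-- In this form only the arrows across which `f` changes contribute, which suits indicators of
cuts. -/
theorem laplacian_mulVec [Fintype V] [DecidableEq V] [∀ v w : V, Finite (v ⟶ w)]
    (hl : ∀ v : V, IsEmpty (v ⟶ v)) (f : V → ℤ) (v : V) :
    (laplacian V).mulVec f v = ∑ w, (Nat.card (v ⟶ w) : ℤ) * (f v - f w) := by
  have hL : ∀ w, laplacian V v w =
      (if v = w then (Nat.card (Quiver.Star v) : ℤ) else 0) - Nat.card (v ⟶ w) := by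
    intro w
    by_cases h : v = w
    · subst h
      have := hl v
      simp [laplacian]
    · simp [laplacian, h]
  simp only [Matrix.mulVec, dotProduct, hL, sub_mul, mul_sub, Finset.sum_sub_distrib, ite_mul,
    zero_mul, Finset.sum_ite_eq, Finset.mem_univ, if_true, card_star, Nat.cast_sum, Finset.sum_mul]

theorem IsDirectedTree.card_hom (hT : IsDirectedTree V) {v w : V} (h : Nonempty (v ⟶ w)) :
    Nat.card (v ⟶ w) = 1 :=
  Nat.card_eq_one_iff_unique.2 ⟨hT.no_parallel v w, h⟩

theorem IsDirectedTree.ne_of_hom (hT : IsDirectedTree V) {v w : V} (h : Nonempty (v ⟶ w)) :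
    v ≠ w := by
  rintro rfl
  exact (hT.loopless v).false h.some

/-- An edge of a directed tree cuts it into two sides, and no other edge crosses the cut. -/
theorem IsDirectedTree.exists_cut (hT : IsDirectedTree V) {u v : V}
    (h : (underlying V).Adj u v) :
    ∃ χ : V → ℤ, χ u = 1 ∧ χ v = 0 ∧ ∀ a b : V, Nonempty (a ⟶ b) → χ a ≠ χ b →
      (a = u ∧ b = v) ∨ (a = v ∧ b = u) := by
  classical
  have hb := SimpleGraph.isBridge_iff.1
    (SimpleGraph.isAcyclic_iff_forall_adj_isBridge.1 hT.isTree.isAcyclic h)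
  -- The indicator of the component of `u` once the bridge is deleted.
  refine ⟨fun a => if ((underlying V).deleteEdges {s(u, v)}).Reachable u a then 1 else 0,
    by simp, by simp [hb], fun a b hab hne => ?_⟩
  by_contra hc
  apply hne
  have hadj : ((underlying V).deleteEdges {s(u, v)}).Adj a b := by
    rw [SimpleGraph.deleteEdges_adj]
    refine ⟨(SimpleGraph.fromRel_adj _ _ _).2 ⟨hT.ne_of_hom hab, Or.inl hab⟩, ?_⟩
    simpa [Sym2.eq_iff] using hc
  have : ((underlying V).deleteEdges {s(u, v)}).Reachable u a ↔
      ((underlying V).deleteEdges {s(u, v)}).Reachable u b :=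
    ⟨fun h => h.trans hadj.reachable, fun h => h.trans hadj.reachable.symm⟩
  simp only [this]

theorem IsDirectedTree.adj_of_hom (hT : IsDirectedTree V) {v w : V} (h : Nonempty (v ⟶ w)) :
    (underlying V).Adj v w :=
  (SimpleGraph.fromRel_adj _ _ _).2 ⟨hT.ne_of_hom h, Or.inl h⟩

/-- In a directed tree an arrow on a directed cycle is bi-directional. -/
theorem IsDirectedTree.hom_symm (hT : IsDirectedTree V) {v w : V} (h : Nonempty (v ⟶ w))
    (p : Nonempty (Quiver.Path w v)) : Nonempty (w ⟶ v) := by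
  by_contra hwv
  obtain ⟨χ, hw, hv, hχ⟩ := hT.exists_cut (hT.adj_of_hom h).symm
  -- A path from `w` could leave its side of the cut only by an arrow `w ⟶ v`.
  have key : ∀ a : V, Quiver.Path w a → χ a = 1 := by
    intro a q
    induction q with
    | nil => exact hw
    | cons q e ih =>
      by_contra hne
      rcases hχ _ _ ⟨e⟩ (by rw [ih]; exact Ne.symm hne) with ⟨rfl, rfl⟩ | ⟨rfl, rfl⟩
      · exact hwv ⟨e⟩
      · exact hne hw
  exact absurd (key v p.some) (by simp [hv])

open Quiver in
theorem IsTerminal.mk_eq_of_path {c : StronglyConnectedComponent V} (hc : IsTerminal c) {v w : V}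
    (hv : StronglyConnectedComponent.mk v = c) (p : Path v w) :
    StronglyConnectedComponent.mk w = c := by
  induction p with
  | nil => exact hv
  | cons q e ih => exact hc _ _ ih ⟨e⟩

open Quiver in
-- Among the vertices reachable from `v`, one with the fewest reachable vertices works: following an
-- arrow cannot shrink that set, so the way back exists.
theorem exists_path_isTerminal [Finite V] (v : V) :
    ∃ w : V, Nonempty (Path v w) ∧ IsTerminal (StronglyConnectedComponent.mk w) := by
  obtain ⟨w, hw, hmin⟩ := Set.exists_min_image {w : V | Nonempty (Path v w)}
    (fun w => Set.ncard {u : V | Nonempty (Path w u)}) (Set.toFinite _) ⟨v, ⟨Path.nil⟩⟩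
  refine ⟨w, hw, fun a b ha ⟨e⟩ => ?_⟩
  have hwa := (exists_path_of_stronglyConnectedComponent_eq ha).2
  have hwb : Nonempty (Path w b) := ⟨hwa.some.cons e⟩
  have hsub : {u : V | Nonempty (Path b u)} ⊆ {u : V | Nonempty (Path w u)} :=
    fun u hu => ⟨hwb.some.comp hu.some⟩
  have heq := Set.eq_of_subset_of_ncard_le hsub (hmin b ⟨hw.some.comp hwb.some⟩)
  have hbw : Nonempty (Path b w) := by
    have : w ∈ {u : V | Nonempty (Path w u)} := ⟨Path.nil⟩
    rwa [← heq] at this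
  exact stronglyConnectedComponent_eq_of_path hbw hwb

/-- The sum of the rows of the Laplacian over a terminal strong component vanishes. -/
theorem IsDirectedTree.sum_row_eq_zero [Fintype V] [DecidableEq V] (hT : IsDirectedTree V)
    {c : Quiver.StronglyConnectedComponent V} (hc : IsTerminal c)
    [DecidablePred fun v : V => Quiver.StronglyConnectedComponent.mk v = c] :
    ∑ v with Quiver.StronglyConnectedComponent.mk v = c, (laplacian V).row v = 0 := by
  have hfin : ∀ v w : V, Finite (v ⟶ w) := fun v w =>
    have := hT.no_parallel v w
    inferInstance
  have hsymm : ∀ v w : V, Quiver.StronglyConnectedComponent.mk v = c →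
      Quiver.StronglyConnectedComponent.mk w = c → Nonempty (v ⟶ w) → Nonempty (w ⟶ v) :=
    fun v w hv hw h => hT.hom_symm h
      (Quiver.exists_path_of_stronglyConnectedComponent_eq (hw.trans hv.symm)).1
  have hcard : ∀ v w : V, Quiver.StronglyConnectedComponent.mk v = c →
      Quiver.StronglyConnectedComponent.mk w = c → Nat.card (v ⟶ w) = Nat.card (w ⟶ v) := by
    intro v w hv hw
    by_cases h : Nonempty (v ⟶ w)
    · rw [hT.card_hom h, hT.card_hom (hsymm v w hv hw h)]
    · have h' : ¬ Nonempty (w ⟶ v) := fun h' => h (hsymm w v hw hv h')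
      rw [not_nonempty_iff] at h h'
      simp
  ext u
  have hrow : ∀ v, (laplacian V).row v u =
      ∑ w, (Nat.card (v ⟶ w) : ℤ) * ((Pi.single u 1 : V → ℤ) v - (Pi.single u 1 : V → ℤ) w) := by
    intro v
    rw [← laplacian_mulVec hT.loopless, Matrix.mulVec_single_one]
    rfl
  have hrow' : ∀ v, Quiver.StronglyConnectedComponent.mk v = c → (laplacian V).row v u =
      ∑ w with Quiver.StronglyConnectedComponent.mk w = c, (Nat.card (v ⟶ w) : ℤ) *
        ((Pi.single u 1 : V → ℤ) v - (Pi.single u 1 : V → ℤ) w) := by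
    intro v hv
    rw [hrow, Finset.sum_filter]
    refine Finset.sum_congr rfl fun w _ => ?_
    split_ifs with hw
    · rfl
    · have : IsEmpty (v ⟶ w) := not_nonempty_iff.1 fun h => hw (hc v w hv h)
      simp
  rw [Finset.sum_apply, Pi.zero_apply,
    Finset.sum_congr rfl fun v hv => hrow' v (Finset.mem_filter.1 hv).2]
  -- Arrow counts inside `c` are symmetric, so exchanging `v` and `w` negates the double sum.
  refine self_eq_neg.1 ?_
  rw [← Finset.sum_neg_distrib]
  conv_lhs => rw [Finset.sum_comm]
  refine Finset.sum_congr rfl fun v hv => ?_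
  rw [← Finset.sum_neg_distrib]
  refine Finset.sum_congr rfl fun w hw => ?_
  rw [hcard v w (Finset.mem_filter.1 hv).2 (Finset.mem_filter.1 hw).2]
  ring

/-- A chosen representative of a terminal strong component. -/
def IsRoot (v : V) : Prop :=
  IsTerminal (Quiver.StronglyConnectedComponent.mk v) ∧
    (Quiver.StronglyConnectedComponent.mk v).out = v

theorem mk_out (c : Quiver.StronglyConnectedComponent V) :
    Quiver.StronglyConnectedComponent.mk c.out = c :=
  Quotient.out_eq' c

theorem card_isRoot : Nat.card {v : V // IsRoot v} = numTerminal V :=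
  Nat.card_congr
    { toFun := fun v => ⟨Quiver.StronglyConnectedComponent.mk v.1, v.2.1⟩
      invFun := fun c => ⟨c.1.out, by rw [IsRoot, mk_out]; exact ⟨c.2, rfl⟩⟩
      left_inv := fun v => Subtype.ext v.2.2
      right_inv := fun c => Subtype.ext (mk_out c.1) }

theorem exists_path_isRoot [Finite V] (v : V) : ∃ w : V, Nonempty (Quiver.Path v w) ∧ IsRoot w := by
  obtain ⟨w, ⟨p⟩, hw⟩ := exists_path_isTerminal v
  refine ⟨(Quiver.StronglyConnectedComponent.mk w).out, ?_, ?_⟩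
  · obtain ⟨-, ⟨q⟩⟩ := Quiver.exists_path_of_stronglyConnectedComponent_eq
      (mk_out (Quiver.StronglyConnectedComponent.mk w))
    exact ⟨p.comp q⟩
  · rw [IsRoot, mk_out]
    exact ⟨hw, rfl⟩

/-- There is a directed walk of length `n` from `v` to a root. -/
def ReachesRoot : ℕ → V → Prop
  | 0, v => IsRoot v
  | n + 1, v => ∃ w : V, Nonempty (v ⟶ w) ∧ ReachesRoot n w

theorem exists_reachesRoot [Finite V] (v : V) : ∃ n, ReachesRoot n v := by
  obtain ⟨w, ⟨p⟩, hw⟩ := exists_path_isRoot v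
  have key : ∀ {a b : V}, Quiver.Path a b → (∃ n, ReachesRoot n b) → ∃ n, ReachesRoot n a := by
    intro a b p
    induction p with
    | nil => exact id
    | cons q e ih => exact fun ⟨n, hn⟩ => ih ⟨n + 1, _, ⟨e⟩, hn⟩
  exact key p ⟨0, hw⟩

/-- A function that decreases along some arrow out of every vertex that is not a root. -/
theorem exists_distance [Finite V] : ∃ d : V → ℕ, ∀ v : V, ¬ IsRoot v →
    ∃ w : V, Nonempty (v ⟶ w) ∧ d w < d v := by
  classical
  -- The length of a shortest directed walk to a root.
  refine ⟨fun v => Nat.find (exists_reachesRoot v), fun v hv => ?_⟩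
  have hs := Nat.find_spec (exists_reachesRoot v)
  generalize hn : Nat.find (exists_reachesRoot v) = n at hs
  cases n with
  | zero => exact absurd hs hv
  | succ n =>
    obtain ⟨w, hvw, hw⟩ := hs
    refine ⟨w, hvw, ?_⟩
    have := Nat.find_min' (exists_reachesRoot w) hw
    exact this.trans_lt (hn.symm ▸ Nat.lt_succ_self n : n < Nat.find (exists_reachesRoot v))

theorem IsDirectedTree.span_row_eq [Fintype V] [DecidableEq V] (hT : IsDirectedTree V) :
    LinearMap.range (Matrix.toLin' (laplacian V).transpose) =
      Submodule.span ℤ (Set.range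
        ((laplacian V).submatrix (Subtype.val : {v : V // ¬ IsRoot v} → V) id).row) := by
  classical
  rw [Matrix.range_toLin', Matrix.col_transpose]
  refine le_antisymm (Submodule.span_le.2 ?_) (Submodule.span_mono ?_)
  · rintro _ ⟨v, rfl⟩
    by_cases hv : IsRoot v
    · have hsum := hT.sum_row_eq_zero hv.1
      rw [← Finset.add_sum_erase _ _ (a := v) (by simp only [Finset.mem_filter_univ]),
        add_eq_zero_iff_eq_neg] at hsum
      rw [SetLike.mem_coe, hsum]
      refine neg_mem (sum_mem fun w hw => Submodule.subset_span ⟨⟨w, fun hw' => ?_⟩, rfl⟩)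
      rw [Finset.mem_erase, Finset.mem_filter] at hw
      -- A component has only one root, so the other rows in the sum are at non-roots.
      exact hw.1 (by rw [← hw'.2, hw.2.2, hv.2])
    · exact Submodule.subset_span ⟨⟨v, hv⟩, rfl⟩
  · rintro _ ⟨v, rfl⟩
    exact ⟨v.1, rfl⟩

/-- The rows of the Laplacian at the vertices that are not roots pair unimodularly with suitable
vectors. -/
theorem IsDirectedTree.exists_dual [Fintype V] [DecidableEq V] (hT : IsDirectedTree V)
    [Fintype {v : V // ¬ IsRoot v}] [DecidableEq {v : V // ¬ IsRoot v}] :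
    ∃ X : Matrix V {v : V // ¬ IsRoot v} ℤ,
      ((laplacian V).submatrix (Subtype.val : {v : V // ¬ IsRoot v} → V) id * X).det = 1 := by
  have hfin : ∀ v w : V, Finite (v ⟶ w) := fun v w =>
    have := hT.no_parallel v w
    inferInstance
  obtain ⟨d, hd⟩ := exists_distance (V := V)
  choose p hp hdp using fun v : {v : V // ¬ IsRoot v} => hd v.1 v.2
  choose χ hχ1 hχ0 hχ using fun v => hT.exists_cut (hT.adj_of_hom (hp v))
  refine ⟨Matrix.of fun u i => χ i u, ?_⟩
  set P := (laplacian V).submatrix (Subtype.val : {v : V // ¬ IsRoot v} → V) id *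
    Matrix.of fun u i => χ i u with hPdef
  have hP : ∀ j i, P j i = ∑ w, (Nat.card (j.1 ⟶ w) : ℤ) * (χ i j.1 - χ i w) := by
    intro j i
    rw [← laplacian_mulVec hT.loopless]
    rfl
  have hterm : ∀ i j w, (Nat.card (j ⟶ w) : ℤ) * (χ i j - χ i w) ≠ 0 →
      (j = i.1 ∧ w = p i) ∨ (j = p i ∧ w = i.1) := by
    intro i j w h
    refine hχ i j w ?_ (sub_ne_zero.1 (right_ne_zero_of_mul h))
    by_contra he
    rw [not_nonempty_iff] at he
    exact h (by simp)
  have hdiag : ∀ i, P i i = 1 := by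
    intro i
    rw [hP, Finset.sum_eq_single (p i)]
    · rw [hT.card_hom (hp i), hχ1, hχ0]
      norm_num
    · intro w _ hw
      by_contra h
      rcases hterm i i.1 w h with h | h
      · exact hw h.2
      · exact hT.ne_of_hom (hp i) h.1
    · simp
  -- Off the diagonal, column `i` can be nonzero only at `p i`, which is closer to a root.
  have hoff : ∀ i j, i ≠ j → P j i ≠ 0 → d j.1 < d i.1 := by
    intro i j hij h
    rw [hP] at h
    obtain ⟨w, -, hw⟩ := Finset.exists_ne_zero_of_sum_ne_zero h
    rcases hterm i j.1 w hw with h | h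
    · exact absurd (Subtype.ext h.1.symm) hij
    · rw [h.1]
      exact hdp i
  have htri : P.BlockTriangular fun i => d i.1 := by
    intro i j hij
    by_contra h
    have := hoff j i (by rintro rfl; exact lt_irrefl _ hij) h
    exact lt_asymm hij this
  rw [htri.det]
  refine Finset.prod_eq_one fun k _ => ?_
  rw [show P.toSquareBlock (fun i => d i.1) k = 1 from ?_, Matrix.det_one]
  ext i j
  rw [Matrix.toSquareBlock_def, Matrix.of_apply, Matrix.one_apply]
  split_ifs with h
  · rw [h, hdiag]
  · by_contra hne
    have := hoff j.1 i.1 (fun h' => h (Subtype.ext h'.symm)) hne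
    rw [i.2, j.2] at this
    exact lt_irrefl _ this

end Laplacian

end DirectedGraph

theorem mainTheorem9 {V : Type*} [Fintype V] [DecidableEq V] [Quiver V]
    (hT : DirectedGraph.IsDirectedTree V) :
    Module.Free ℤ (DirectedGraph.Pic V) ∧
      Module.rank ℤ (DirectedGraph.Pic V) = (DirectedGraph.numTerminal V : Cardinal) := by
  classical
  obtain ⟨X, hX⟩ := hT.exists_dual
  have h := DirectedGraph.free_quotient_span_row_of_det_eq_one _ X hX
  rw [← hT.span_row_eq, Fintype.card_subtype_compl] at h
  refine ⟨h.1, ?_⟩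
  -- The number of non-roots appears in `h` as a truncated subtraction; this bound makes it exact.
  have hle := Fintype.card_subtype_le fun v : V => DirectedGraph.IsRoot v
  have := h.1
  rw [← Module.finrank_eq_rank, ← DirectedGraph.card_isRoot, Nat.card_eq_fintype_card]
  congr 1
  refine Nat.add_left_cancel (h.2.trans ?_)
  omega
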